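/- Fix an effective (Gödel) numbering $(\varphi_e)_{e\in\mathbb N}$ of all partial computable functions $\mathbb N\rightharpoonup\mathbb N$ and let $W_e=\operatorname{dom}(\varphi_e)$. A text is a total function $T\colon\mathbb N\to\mathbb N\cup\{\#\}$ with content $\operatorname{content}(T)=\operatorname{range}(T)\setminus\{\#\}$ (and likewise for finite sequences); $T$ is a text of a language $L\subseteq\mathbb N$ if $\operatorname{content}(T)=L$; and $T[n]=(T(0),\dots,T(n-1))$. A (Gold-style) learner is a partial computable function $h$ mapping finite sequences over $\mathbb N\cup\{\#\}$ to $\mathbb N$; on a text $T$ it produces the (possibly partial) sequence of hypotheses $p_{h,T}(n)=h(T[n])$. For a total sequence $p\colon\mathbb N\to\mathbb N$ and a text $T$ let \begin{align*} \mathbf{Bc}(p,T)&:\Leftrightarrow \exists n_0\,\forall n\ge n_0\colon W_{p(n)}=\operatorname{content}(T),\\ \mathbf{SemConv}(p,T)&:\Leftrightarrow \forall n<m\colon \operatorname{content}(T[m])\subseteq W_{p(n)}\Rightarrow W_{p(n)}=W_{p(m)}. \end{align*} Let $[\mathbf{Txt}\mathbf{G}\mathbf{SemConv}\mathbf{Bc}]$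 be the set of all classes $\mathcal L$ of languages for which there is a learner $h$ such that for every $L\in\mathcal L$ and every text $T$ of $L$, the sequence $p_{h,T}$ is total and satisfies both $\mathbf{SemConv}(p_{h,T},T)$ and $\mathbf{Bc}(p_{h,T},T)$. Let $[\tau(\mathbf{SemConv})\mathbf{Txt}\mathbf{G}\mathbf{Bc}]$ be the set of all classes $\mathcal L$ of languages for which there is a learner $h$ such that, for every $L\in\mathcal L$, (i) for every text $T$ whatsoever, $p_{h,T}$ is total and satisfies $\mathbf{SemConv}(p_{h,T},T)$, and (ii) for every text $T$ of $L$, $\mathbf{Bc}(p_{h,T},T)$ holds. Theorem. $[\tau(\mathbf{SemConv})\mathbf{Txt}\mathbf{G}\mathbf{Bc}]=[\mathbf{Txt}\mathbf{G}\mathbf{SemConv}\mathbf{Bc}]$. That is, Gold-style semantically conservative behaviourally correct learners may be assumed globally semantically conservative without losing learning power. -/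

import Mathlib

namespace LimitLearning

/-- The partial computable function `φ_e` with index `e`. -/
def phi (e : ℕ) : ℕ →. ℕ := (Denumerable.ofNat Nat.Partrec.Code e).eval

/-- The computably enumerable set `W_e = dom φ_e`. -/
def W (e : ℕ) : Set ℕ := (phi e).Dom

/-- A text is a total function into `ℕ ∪ {#}`; the pause symbol `#` is `none`. -/
abbrev Text : Type := ℕ → Option ℕ

/-- Finite sequences over `ℕ ∪ {#}`. -/
abbrev Sequence : Type := List (Option ℕ)

/-- The content of a text: its range without the pause symbol. -/
def Text.content (T : Text) : Set ℕ := {x | ∃ i, T i = some x}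

/-- The content of a finite sequence. -/
def Sequence.content (s : Sequence) : Set ℕ := {x | some x ∈ s}

/-- The initial sequence `T[n] = (T 0, …, T (n - 1))`. -/
def Text.initial (T : Text) (n : ℕ) : Sequence := (List.range n).map T

/-- `T` is a text of the language `L`. -/
def Text.IsTextOf (T : Text) (L : Set ℕ) : Prop := T.content = L

/-- The Gold-style (full-information) interaction operator, `G(h, T)(i) = h(T[i])`. -/
def gold (h : Sequence →. ℕ) (T : Text) : ℕ →. ℕ := fun i => h (T.initial i)

/-- Behaviourally correct convergence of a (total) learning sequence on a text. -/
def Bc (p : ℕ → ℕ) (T : Text) : Prop :=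
  ∃ n₀, ∀ n, n₀ ≤ n → W (p n) = T.content

/-- Semantic conservativeness of a (total) learning sequence on a text. -/
def SemConv (p : ℕ → ℕ) (T : Text) : Prop :=
  ∀ n m, n < m → Sequence.content (T.initial m) ⊆ W (p n) → W (p n) = W (p m)

/-- Predicates on the possibly partial sequence of hypotheses and a text. -/
abbrev Restriction : Type := (ℕ →. ℕ) → Text → Prop

/-- A learning restriction is a predicate on total learning sequences; imposing it on a
possibly partial sequence includes the demand that the sequence is total. -/
def Restriction.ofTotal (δ : (ℕ → ℕ) → Text → Prop) : Restriction :=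
  fun p T => ∃ q : ℕ → ℕ, p = (q : ℕ →. ℕ) ∧ δ q T

/-- The absence of a restriction; in particular the hypotheses may be undefined. -/
def Restriction.none : Restriction := fun _ _ => True

/-- `h` learns `L`: `α` holds on arbitrary texts, and `δ` holds on all texts of `L`. -/
def Learns (α : Restriction) (β : (Sequence →. ℕ) → Text → (ℕ →. ℕ)) (δ : Restriction)
    (h : Sequence →. ℕ) (L : Set ℕ) : Prop :=
  (∀ T : Text, α (β h T) T) ∧ ∀ T : Text, T.IsTextOf L → δ (β h T) T

/-- `[τ(α)Txtβδ]`: the set of all classes of languages that are learnable, that is, for which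
one partial computable learner learns every language of the class. -/
def Learnable (α : Restriction) (β : (Sequence →. ℕ) → Text → (ℕ →. ℕ)) (δ : Restriction) :
    Set (Set (Set ℕ)) :=
  {𝓛 | ∃ h : Sequence →. ℕ, Partrec h ∧ ∀ L ∈ 𝓛, Learns α β δ h L}

end LimitLearning

open LimitLearning

/-! Only turning a learner `h` that is conservative on texts of the class into a globally
conservative one needs work. Let `A s σ` enumerate the hypothesis of `h` on `σ`. In stages, each `σ`
makes finite claims: approximations to its hypothesis, closed under the claims of proper extensions
whose content they cover. A new claim is allowed only if the old claims of `σ` are verified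
(contained in `A s σ`) and no claim of a proper prefix covers the content of `σ`. Hence a claim
covering the content of an extension contains every claim of that extension
(`Claim.subset_of_prefix`), whatever `h` does.

The new hypothesis on `τ` enumerates `own ρ`, the union of the verified claims of `ρ`, for the
shortest prefix `ρ` whose `own` covers the content of `τ` (or `τ` itself). This choice does not
change while the content stays covered, which gives global conservativeness
(`output_eq_of_content_subset`).

On a text of a learned `L`, closing never leaves `L` when the old hypothesis is `L`, and an
unblocked sequence with that hypothesis has `own` equal to `L` (`own_eq_of_unblocked`). For infinite
`L`, the finitely many initial segments with wrong hypotheses eventually cover nothing relevant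
(`exists_not_covered`); finite `L` is handled by trivial claims. -/

namespace LimitLearning

/-! ### Contents, prefixes and closure under claims -/

/-- The content of a finite sequence, as a list. -/
def contentList (σ : Sequence) : List ℕ := σ.filterMap id

theorem mem_contentList {σ : Sequence} {x : ℕ} : x ∈ contentList σ ↔ x ∈ σ.content := by
  simp [contentList, Sequence.content]

theorem content_mono {σ τ : Sequence} (h : σ <+: τ) : σ.content ⊆ τ.content :=
  fun _ hx => h.subset hx

theorem contentList_mono {σ τ : Sequence} (h : σ <+: τ) : contentList σ ⊆ contentList τ :=
  fun _ hx => mem_contentList.2 (content_mono h (mem_contentList.1 hx))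

/-- The prefixes of a finite sequence. -/
def prefixes (σ : Sequence) : List Sequence := (List.range (σ.length + 1)).map fun n => σ.take n

theorem mem_prefixes {ρ σ : Sequence} : ρ ∈ prefixes σ ↔ ρ <+: σ := by
  simp only [prefixes, List.mem_map, List.mem_range]
  constructor
  · rintro ⟨n, -, rfl⟩
    exact List.take_prefix n σ
  · intro h
    exact ⟨ρ.length, Nat.lt_succ_of_le h.length_le, (List.prefix_iff_eq_take.1 h).symm⟩

/-- The pair `p = (τ, K)` is a rule that forces a claim `C` of `σ` to include `K`. -/
def Forces (p : Sequence × List ℕ) (c : Sequence × List ℕ) : Prop :=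
  (c.1 <+: p.1 ∧ c.1 ≠ p.1) ∧ contentList p.1 ⊆ c.2

instance : DecidableRel Forces := fun p c => by unfold Forces; infer_instance

/-- One round of closing `C` under the claims in `H` that belong to proper extensions of `σ`. -/
def expand (H : List (Sequence × List ℕ)) (σ : Sequence) (C : List ℕ) : List ℕ :=
  C ++ (H.filter fun p => Forces p (σ, C)).flatMap Prod.snd

/-- The closure of `C` under the claims in `H` that belong to proper extensions of `σ`. -/
def closeUnder (H : List (Sequence × List ℕ)) (σ : Sequence) (C : List ℕ) : List ℕ :=
  (expand H σ)^[H.length] C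

theorem mem_expand {H : List (Sequence × List ℕ)} {σ : Sequence} {C : List ℕ} {x : ℕ} :
    x ∈ expand H σ C ↔ x ∈ C ∨ ∃ p ∈ H, Forces p (σ, C) ∧ x ∈ p.2 := by
  simp only [expand, List.mem_append, List.mem_flatMap, List.mem_filter, decide_eq_true_eq]
  grind

theorem subset_iterate_expand (H : List (Sequence × List ℕ)) (σ : Sequence) (C : List ℕ) (n : ℕ) :
    C ⊆ (expand H σ)^[n] C := by
  induction n with
  | zero => simp
  | succ n ih =>
    rw [Function.iterate_succ_apply']
    exact fun x hx => mem_expand.2 (Or.inl (ih hx))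

theorem subset_closeUnder (H : List (Sequence × List ℕ)) (σ : Sequence) (C : List ℕ) :
    C ⊆ closeUnder H σ C :=
  subset_iterate_expand H σ C _

theorem closeUnder_minimal {H : List (Sequence × List ℕ)} {σ : Sequence} {C : List ℕ} {X : Set ℕ}
    (hC : ∀ x ∈ C, x ∈ X)
    (hX : ∀ p ∈ H, σ <+: p.1 → σ ≠ p.1 → p.1.content ⊆ X → ∀ x ∈ p.2, x ∈ X) :
    ∀ x ∈ closeUnder H σ C, x ∈ X := by
  unfold closeUnder
  generalize H.length = n
  induction n with
  | zero => exact hC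
  | succ n ih =>
    rw [Function.iterate_succ_apply']
    intro x hx
    rcases mem_expand.1 hx with hx | ⟨p, hp, hf, hx⟩
    · exact ih x hx
    · exact hX p hp hf.1.1 hf.1.2 (fun y hy => ih y (hf.2 (mem_contentList.2 hy))) x hx

theorem countP_lt_countP {α : Type*} {p q : α → Bool} {l : List α} (h : ∀ a ∈ l, p a → q a)
    {a : α} (ha : a ∈ l) (hp : p a = false) (hq : q a) : l.countP p < l.countP q := by
  induction l with
  | nil => simp at ha
  | cons b l ih =>
    have hle : l.countP p ≤ l.countP q :=
      List.countP_mono_left fun x hx => h x (List.mem_cons_of_mem _ hx)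
    rcases List.mem_cons.1 ha with rfl | ha
    · simp only [List.countP_cons, hp, hq]
      simpa using Nat.lt_succ_of_le hle
    · have := ih (fun x hx => h x (List.mem_cons_of_mem _ hx)) ha
      have hb := h b List.mem_cons_self
      simp only [List.countP_cons]
      by_cases hpb : p b
      · simp [hpb, hb hpb, this]
      · simp only [hpb]
        exact lt_of_lt_of_le (by simpa using this) (Nat.le_add_right _ _)

/-- Every round that starts from a set not yet closed satisfies a further rule of `H`, so `H.length`
rounds suffice. -/
theorem closeUnder_closed {H : List (Sequence × List ℕ)} {σ : Sequence} {C : List ℕ}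
    {p : Sequence × List ℕ} (hp : p ∈ H) (h₁ : σ <+: p.1) (h₂ : σ ≠ p.1)
    (h₃ : contentList p.1 ⊆ closeUnder H σ C) : p.2 ⊆ closeUnder H σ C := by
  let S : ℕ → List ℕ := fun n => (expand H σ)^[n] C
  have hS : ∀ n, S (n + 1) = expand H σ (S n) := fun n => Function.iterate_succ_apply' _ _ _
  have hmono : ∀ n, S n ⊆ S (n + 1) := fun n x hx => by
    rw [hS]; exact mem_expand.2 (Or.inl hx)
  have hforce : ∀ n, ∀ q ∈ H, Forces q (σ, S n) → q.2 ⊆ S (n + 1) := fun n q hq hf x hx => by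
    rw [hS]; exact mem_expand.2 (Or.inr ⟨q, hq, hf, hx⟩)
  have key : ∀ n, (∃ q ∈ H, Forces q (σ, S n) ∧ ¬ q.2 ⊆ S n) →
      n + 1 ≤ H.countP fun q => decide (q.2 ⊆ S (n + 1)) := by
    intro n
    induction n with
    | zero =>
      rintro ⟨q, hq, hf, -⟩
      exact List.countP_pos_iff.2 ⟨q, hq, by simpa using hforce 0 q hq hf⟩
    | succ n ih =>
      rintro ⟨q, hq, hf, hn⟩
      -- Otherwise round `n` was already closed, and later rounds would add nothing.
      have hprev : ∃ q ∈ H, Forces q (σ, S n) ∧ ¬ q.2 ⊆ S n := by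
        by_contra hcon
        push Not at hcon
        have heq : S (n + 1) ⊆ S n := by
          intro x hx
          rw [hS] at hx
          rcases mem_expand.1 hx with hx | ⟨r, hr, hfr, hx⟩
          · exact hx
          · exact hcon r hr hfr hx
        exact hn (List.Subset.trans (hcon q hq ⟨hf.1, fun x hx => heq (hf.2 hx)⟩) (hmono n))
      refine lt_of_le_of_lt (ih hprev) (countP_lt_countP ?_ hq (by simpa using hn) ?_)
      · intro r _ hr
        simp only [decide_eq_true_eq] at hr ⊢
        exact List.Subset.trans hr (hmono _)
      · simpa using hforce (n + 1) q hq hf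
  by_contra hcon
  -- This would give `H.length + 1` satisfied entries in `H`.
  have := key H.length ⟨p, hp, ⟨⟨h₁, h₂⟩, h₃⟩, hcon⟩
  exact absurd (this.trans List.countP_le_length) (by simp)

/-! ### The staged construction of claims -/

/-- A recorded or trivial claim `p` does not prevent `c.1` from claiming a superset of `c.2`. -/
def Permits (p : Sequence × List ℕ) (c : Sequence × List ℕ) : Prop :=
  (p.1 = c.1 → p.2 ⊆ c.2) ∧ (p.1 <+: c.1 ∧ p.1 ≠ c.1 → ¬ contentList c.1 ⊆ p.2)

instance : DecidableRel Permits := fun p c => by unfold Permits; infer_instance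

/-- The recorded claims together with the trivial claims of the prefixes of `σ`. -/
def withTrivial (H : List (Sequence × List ℕ)) (σ : Sequence) : List (Sequence × List ℕ) :=
  H ++ (prefixes σ).map fun ρ => (ρ, contentList ρ)

/-- The sequence treated at stage `s`. -/
def selected (s : ℕ) : Sequence := Denumerable.ofNat Sequence s.unpair.1

/-- The claims recorded before stage `s`, for the approximation `A`. -/
def history (A : ℕ → Sequence → List ℕ) : ℕ → List (Sequence × List ℕ)
  | 0 => []
  | s + 1 =>
    if ∀ p ∈ withTrivial (history A s) (selected s), Permits p (selected s, A s (selected s)) then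
      (selected s, closeUnder (history A s) (selected s) (A s (selected s))) :: history A s
    else history A s

/-- `K` is a claim of `σ` before stage `s`; the content of `σ` is a trivial claim. -/
def Claim (A : ℕ → Sequence → List ℕ) (s : ℕ) (σ : Sequence) (K : List ℕ) : Prop :=
  (σ, K) ∈ history A s ∨ K = contentList σ

/-- At stage `s` the sequence `σ` is allowed to make a new claim. -/
def Acts (A : ℕ → Sequence → List ℕ) (s : ℕ) (σ : Sequence) : Prop :=
  (∀ K, Claim A s σ K → K ⊆ A s σ) ∧
    ∀ ρ K, ρ <+: σ → ρ ≠ σ → Claim A s ρ K → ¬ contentList σ ⊆ K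

section Construction

variable {A : ℕ → Sequence → List ℕ}

/-- Links the finite test used in `history`, suited to primitive recursion, with the form used in
arguments. -/
theorem permits_iff_acts {s : ℕ} {σ : Sequence} :
    (∀ p ∈ withTrivial (history A s) σ, Permits p (σ, A s σ)) ↔ Acts A s σ := by
  constructor
  · intro h
    refine ⟨?_, ?_⟩
    · rintro K (hK | rfl)
      · exact (h (σ, K) (List.mem_append_left _ hK)).1 rfl
      · exact (h (σ, contentList σ) (List.mem_append_right _
          (List.mem_map.2 ⟨σ, mem_prefixes.2 (List.prefix_refl _), rfl⟩))).1 rfl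
    · rintro ρ K hρ hne (hK | rfl)
      · exact (h (ρ, K) (List.mem_append_left _ hK)).2 ⟨hρ, hne⟩
      · exact (h (ρ, contentList ρ) (List.mem_append_right _
          (List.mem_map.2 ⟨ρ, mem_prefixes.2 hρ, rfl⟩))).2 ⟨hρ, hne⟩
  · rintro ⟨h₁, h₂⟩ ⟨ρ, K⟩ hp
    have hc : Claim A s ρ K := by
      rcases List.mem_append.1 hp with hp | hp
      · exact Or.inl hp
      · obtain ⟨ρ', -, he⟩ := List.mem_map.1 hp
        cases he
        exact Or.inr rfl
    refine ⟨?_, fun h => h₂ ρ K h.1 h.2 hc⟩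
    rintro rfl
    exact h₁ K hc

theorem claim_succ {s : ℕ} {σ : Sequence} {K : List ℕ} :
    Claim A (s + 1) σ K ↔ Claim A s σ K ∨
      (σ = selected s ∧ Acts A s σ ∧ K = closeUnder (history A s) σ (A s σ)) := by
  unfold Claim
  rw [history]
  split_ifs with h
  · have h' := permits_iff_acts.1 h
    rw [List.mem_cons, Prod.mk.injEq]
    constructor
    · rintro ((⟨rfl, rfl⟩ | h) | h)
      · exact Or.inr ⟨rfl, h', rfl⟩
      · exact Or.inl (Or.inl h)
      · exact Or.inl (Or.inr h)
    · rintro ((h | h) | ⟨rfl, -, rfl⟩)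
      · exact Or.inl (Or.inr h)
      · exact Or.inr h
      · exact Or.inl (Or.inl ⟨rfl, rfl⟩)
  · constructor
    · exact Or.inl
    · rintro (h' | ⟨rfl, h', -⟩)
      · exact h'
      · exact absurd (permits_iff_acts.2 h') h

theorem Claim.mono {s t : ℕ} (h : s ≤ t) {σ : Sequence} {K : List ℕ} (hK : Claim A s σ K) :
    Claim A t σ K := by
  induction h with
  | refl => exact hK
  | step _ ih => exact claim_succ.2 (Or.inl ih)

theorem claim_trivial (s : ℕ) (σ : Sequence) : Claim A s σ (contentList σ) := Or.inr rfl

/-- A claim of `σ` that covers the content of a proper extension covers all its claims. -/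
theorem Claim.subset_of_prefix {s : ℕ} {σ τ : Sequence} {K K' : List ℕ} (hK : Claim A s σ K)
    (hK' : Claim A s τ K') (h : σ <+: τ) (hne : σ ≠ τ) (hc : contentList τ ⊆ K) : K' ⊆ K := by
  induction s generalizing K K' with
  | zero =>
    rcases hK' with hK' | rfl
    · simp [history] at hK'
    · exact hc
  | succ s ih =>
    rcases claim_succ.1 hK with hK | ⟨hσ, -, rfl⟩
    · rcases claim_succ.1 hK' with hK' | ⟨-, hact, rfl⟩
      · exact ih hK hK' hc
      -- Here the extension would act after `K` was claimed, but `K` blocks it.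
      · exact absurd hc (hact.2 σ K h hne hK)
    · rcases claim_succ.1 hK' with (hK' | rfl) | ⟨hτ, -, -⟩
      -- Here `σ` acts later, and closing absorbs the claim already recorded.
      · exact closeUnder_closed hK' h hne hc
      · exact hc
      · exact absurd (hσ.trans hτ.symm) hne

variable (hA : ∀ {s t σ}, s ≤ t → A s σ ⊆ A t σ)
include hA

/-- The claims of a sequence are nested, and only the largest may be unverified. -/
theorem Claim.nested {s : ℕ} {σ : Sequence} {K K' : List ℕ} (hK : Claim A s σ K)
    (hK' : Claim A s σ K') :
    K = K' ∨ (K ⊆ K' ∧ K ⊆ A s σ) ∨ (K' ⊆ K ∧ K' ⊆ A s σ) := by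
  induction s with
  | zero =>
    rcases hK with hK | rfl
    · simp [history] at hK
    rcases hK' with hK' | rfl
    · simp [history] at hK'
    exact Or.inl rfl
  | succ s ih =>
    have hs : A s σ ⊆ A (s + 1) σ := hA (Nat.le_succ s)
    rcases claim_succ.1 hK with hK | ⟨hσ, hact, rfl⟩
    · rcases claim_succ.1 hK' with hK' | ⟨-, hact, rfl⟩
      · rcases ih hK hK' with h | ⟨h, h'⟩ | ⟨h, h'⟩
        · exact Or.inl h
        · exact Or.inr (Or.inl ⟨h, List.Subset.trans h' hs⟩)
        · exact Or.inr (Or.inr ⟨h, List.Subset.trans h' hs⟩)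
      · have := hact.1 K hK
        exact Or.inr (Or.inl ⟨List.Subset.trans this (subset_closeUnder _ _ _), List.Subset.trans this hs⟩)
    · rcases claim_succ.1 hK' with hK' | ⟨-, -, rfl⟩
      · have := hact.1 K' hK'
        exact Or.inr (Or.inr ⟨List.Subset.trans this (subset_closeUnder _ _ _), List.Subset.trans this hs⟩)
      · exact Or.inl rfl

end Construction

/-! ### The new hypotheses and their global conservativeness -/

/-- The elements of the claims of `σ` that are verified at stage `s`. -/
def verified (A : ℕ → Sequence → List ℕ) (s : ℕ) (σ : Sequence) : List ℕ :=
  ((history A s ++ [(σ, contentList σ)]).filter fun p => p.1 = σ ∧ p.2 ⊆ A s σ).flatMap Prod.snd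

theorem mem_verified {A : ℕ → Sequence → List ℕ} {s : ℕ} {σ : Sequence} {x : ℕ} :
    x ∈ verified A s σ ↔ ∃ K, Claim A s σ K ∧ K ⊆ A s σ ∧ x ∈ K := by
  simp only [verified, List.mem_flatMap, List.mem_filter, List.mem_append, List.mem_singleton,
    decide_eq_true_eq, Prod.exists, Prod.mk.injEq, Claim]
  constructor
  · rintro ⟨τ, K, ⟨h, rfl, hK⟩, hx⟩
    exact ⟨K, h.imp id And.right, hK, hx⟩
  · rintro ⟨K, h, hK, hx⟩
    exact ⟨σ, K, ⟨h.imp id fun h => ⟨rfl, h⟩, rfl, hK⟩, hx⟩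

/-- The union of the claims of `σ` that are verified at some stage. -/
def own (A : ℕ → Sequence → List ℕ) (σ : Sequence) : Set ℕ := {x | ∃ s, x ∈ verified A s σ}

/-- The set approximated by `A` at `σ`. -/
def limitSet (A : ℕ → Sequence → List ℕ) (σ : Sequence) : Set ℕ := {x | ∃ s, x ∈ A s σ}

/-- Stage `s` of the enumeration of the new hypothesis at `τ`. -/
def outputAt (A : ℕ → Sequence → List ℕ) (s : ℕ) (τ : Sequence) : List ℕ :=
  ((prefixes τ).filter fun ρ => ρ = τ ∨ contentList τ ⊆ verified A s ρ).flatMap (verified A s)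

/-- The set described by the new hypothesis at `τ`. -/
def output (A : ℕ → Sequence → List ℕ) (τ : Sequence) : Set ℕ := {x | ∃ s, x ∈ outputAt A s τ}

theorem exists_stage_of_subset {B : ℕ → List ℕ} (hB : ∀ {s t}, s ≤ t → B s ⊆ B t) (l : List ℕ)
    (h : ∀ x ∈ l, ∃ s, x ∈ B s) : ∃ s, l ⊆ B s := by
  induction l with
  | nil => exact ⟨0, List.nil_subset _⟩
  | cons a l ih =>
    obtain ⟨s, hs⟩ := ih fun x hx => h x (List.mem_cons_of_mem _ hx)
    obtain ⟨t, ht⟩ := h a List.mem_cons_self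
    refine ⟨max s t, List.cons_subset.2 ⟨hB (le_max_right _ _) ht, List.Subset.trans hs (hB (le_max_left _ _))⟩⟩

section Output

variable {A : ℕ → Sequence → List ℕ} (hA : ∀ {s t σ}, s ≤ t → A s σ ⊆ A t σ)

theorem own_subset_limitSet (σ : Sequence) : own A σ ⊆ limitSet A σ := by
  rintro x ⟨s, hx⟩
  obtain ⟨K, -, hK, hx⟩ := mem_verified.1 hx
  exact ⟨s, hK hx⟩

include hA

theorem verified_mono {s t : ℕ} (h : s ≤ t) (σ : Sequence) : verified A s σ ⊆ verified A t σ := by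
  intro x hx
  obtain ⟨K, hK, hKA, hx⟩ := mem_verified.1 hx
  exact mem_verified.2 ⟨K, hK.mono h, List.Subset.trans hKA (hA h), hx⟩

theorem exists_stage_own {τ σ : Sequence} (h : τ.content ⊆ own A σ) :
    ∃ s, contentList τ ⊆ verified A s σ :=
  exists_stage_of_subset (fun h => verified_mono @hA h σ) _
    fun _ hx => h (mem_contentList.1 hx)

theorem exists_claim_of_content_subset {τ σ : Sequence} (hστ : σ <+: τ)
    (h : τ.content ⊆ own A σ) :
    ∃ s K, Claim A s σ K ∧ K ⊆ A s σ ∧ contentList τ ⊆ K := by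
  obtain ⟨s, hs⟩ := exists_stage_own @hA h
  -- Claims of `σ` form a chain, so finitely many verified elements lie in a single verified claim.
  have main : ∀ l ⊆ verified A s σ, l ≠ [] → ∃ K, Claim A s σ K ∧ K ⊆ A s σ ∧ l ⊆ K := by
    intro l
    induction l with
    | nil => simp
    | cons a l ih =>
      intro hl _
      rw [List.cons_subset] at hl
      obtain ⟨K, hK, hKA, ha⟩ := mem_verified.1 hl.1
      rcases eq_or_ne l [] with rfl | hne
      · exact ⟨K, hK, hKA, by simpa using ha⟩
      obtain ⟨K', hK', hKA', hl'⟩ := ih hl.2 hne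
      rcases hK.nested @hA hK' with rfl | ⟨hs, -⟩ | ⟨hs, -⟩
      · exact ⟨K, hK, hKA, List.cons_subset.2 ⟨ha, hl'⟩⟩
      · exact ⟨K', hK', hKA', List.cons_subset.2 ⟨hs ha, hl'⟩⟩
      · exact ⟨K, hK, hKA, List.cons_subset.2 ⟨ha, List.Subset.trans hl' hs⟩⟩
  rcases eq_or_ne (contentList τ) [] with h0 | h0
  · have h1 : contentList σ = [] := List.subset_nil.1 (h0 ▸ contentList_mono hστ)
    exact ⟨s, contentList σ, claim_trivial _ _, by simp [h1], by simp [h0]⟩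
  · obtain ⟨K, hK⟩ := main _ hs h0
    exact ⟨s, K, hK⟩

/-- For a proper extension, a single verified claim of `σ` covers the content of `τ`, hence contains
all claims of `τ`. -/
theorem own_subset_own {σ τ : Sequence} (h : σ <+: τ) (hc : τ.content ⊆ own A σ) :
    own A τ ⊆ own A σ := by
  rcases eq_or_ne σ τ with rfl | hne
  · exact subset_rfl
  obtain ⟨s, K, hK, hKA, hcK⟩ := exists_claim_of_content_subset @hA h hc
  rintro x ⟨t, hx⟩
  obtain ⟨K', hK', -, hx⟩ := mem_verified.1 hx
  have := (hK.mono (le_max_left s t)).subset_of_prefix (hK'.mono (le_max_right s t)) h hne hcK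
  exact ⟨s, mem_verified.2 ⟨K, hK, hKA, this hx⟩⟩

theorem mem_output {τ : Sequence} {x : ℕ} :
    x ∈ output A τ ↔ ∃ ρ, ρ <+: τ ∧ (ρ = τ ∨ τ.content ⊆ own A ρ) ∧ x ∈ own A ρ := by
  simp only [output, outputAt, Set.mem_ofPred_eq, List.mem_flatMap, List.mem_filter,
    mem_prefixes, decide_eq_true_eq]
  constructor
  · rintro ⟨s, ρ, ⟨hρ, h⟩, hx⟩
    exact ⟨ρ, hρ, h.imp id fun h y hy => ⟨s, h (mem_contentList.2 hy)⟩, s, hx⟩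
  · rintro ⟨ρ, hρ, h, t, hx⟩
    rcases h with rfl | h
    · exact ⟨t, ρ, ⟨hρ, Or.inl rfl⟩, hx⟩
    · obtain ⟨s, hs⟩ := exists_stage_own @hA h
      exact ⟨max s t, ρ, ⟨hρ, Or.inr (List.Subset.trans hs (verified_mono @hA (le_max_left _ _) _))⟩,
        verified_mono @hA (le_max_right _ _) _ hx⟩

/-- The output at `τ` is `own` of the shortest prefix whose `own` covers the content of `τ`. -/
theorem exists_output_eq_own (τ : Sequence) :
    ∃ ρ, ρ <+: τ ∧ (ρ = τ ∨ τ.content ⊆ own A ρ) ∧ output A τ = own A ρ ∧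
      ∀ ρ', ρ' <+: τ → τ.content ⊆ own A ρ' → ρ <+: ρ' := by
  classical
  have hex : ∃ n, ∃ ρ, ρ.length = n ∧ ρ <+: τ ∧ (ρ = τ ∨ τ.content ⊆ own A ρ) :=
    ⟨_, τ, rfl, List.prefix_refl _, Or.inl rfl⟩
  obtain ⟨ρ, hlen, hρ, hcond⟩ := Nat.find_spec hex
  have hmin : ∀ ρ', ρ' <+: τ → (ρ' = τ ∨ τ.content ⊆ own A ρ') → ρ <+: ρ' := by
    intro ρ' hρ' h
    refine List.prefix_of_prefix_length_le hρ hρ' ?_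
    rw [hlen]
    exact Nat.find_min' hex ⟨ρ', rfl, hρ', h⟩
  refine ⟨ρ, hρ, hcond, ?_, fun ρ' h h' => hmin ρ' h (Or.inr h')⟩
  ext x
  rw [mem_output @hA]
  constructor
  · rintro ⟨ρ', hρ', h, hx⟩
    have hle := hmin ρ' hρ' h
    rcases hcond with rfl | hc
    · rwa [List.IsPrefix.eq_of_length_le hle hρ'.length_le]
    · exact own_subset_own @hA hle ((content_mono hρ').trans hc) hx
  · exact fun hx => ⟨ρ, hρ, hcond, hx⟩

/-- The new hypotheses are semantically conservative on all sequences. -/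
theorem output_eq_of_content_subset {σ τ : Sequence} (h : σ <+: τ)
    (hc : τ.content ⊆ output A σ) : output A σ = output A τ := by
  obtain ⟨ρ, hρ, hcond, heq, hmin⟩ := exists_output_eq_own @hA σ
  obtain ⟨ρ', hρ', hcond', heq', hmin'⟩ := exists_output_eq_own @hA τ
  have hcρ : τ.content ⊆ own A ρ := heq ▸ hc
  have h1 : ρ' <+: ρ := hmin' ρ (hρ.trans h) hcρ
  rw [heq, heq']
  -- Conversely, a prefix of `σ` covering the content of `τ` covers that of `σ`, so minimality of
  -- `ρ` applies.
  have h2 : ρ <+: ρ' := by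
    rcases hcond' with rfl | h'
    · exact hρ.trans h
    · exact hmin ρ' (h1.trans hρ) ((content_mono h).trans h')
  rw [List.IsPrefix.eq_of_length_le h1 h2.length_le]

end Output

/-! ### Behaviourally correct convergence on texts -/

theorem initial_length (T : Text) (n : ℕ) : (T.initial n).length = n := by
  simp [Text.initial]

theorem initial_prefix (T : Text) {m n : ℕ} (h : m ≤ n) : T.initial m <+: T.initial n := by
  obtain ⟨d, rfl⟩ := Nat.exists_eq_add_of_le h
  simp only [Text.initial, List.range_add, List.map_append]
  exact List.prefix_append _ _

theorem eq_initial_of_prefix {T : Text} {n : ℕ} {ρ : Sequence} (h : ρ <+: T.initial n) :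
    ∃ m ≤ n, ρ = T.initial m := by
  have hle : ρ.length ≤ n := initial_length T n ▸ h.length_le
  refine ⟨ρ.length, hle, ?_⟩
  exact List.IsPrefix.eq_of_length
    (List.prefix_of_prefix_length_le h (initial_prefix T hle) (initial_length T _).ge)
    (initial_length T _).symm

theorem mem_content_initial {T : Text} {n x : ℕ} :
    x ∈ (T.initial n).content ↔ ∃ i < n, T i = some x := by
  simp [Sequence.content, Text.initial]

theorem content_initial_subset (T : Text) (n : ℕ) : (T.initial n).content ⊆ T.content := by
  intro x hx
  obtain ⟨i, -, hi⟩ := mem_content_initial.1 hx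
  exact ⟨i, hi⟩

theorem exists_mem_content_initial {T : Text} {x : ℕ} (hx : x ∈ T.content) :
    ∃ N, ∀ n ≥ N, x ∈ (T.initial n).content := by
  obtain ⟨i, hi⟩ := hx
  exact ⟨i + 1, fun n hn => mem_content_initial.2 ⟨i, hn, hi⟩⟩

/-- On sequences over `L`, the sets described by `A` are semantically conservative. -/
def ConservativeOn (A : ℕ → Sequence → List ℕ) (L : Set ℕ) : Prop :=
  ∀ σ τ : Sequence, σ <+: τ → τ.content ⊆ L → τ.content ⊆ limitSet A σ →
    limitSet A σ = limitSet A τ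

section Convergence

variable {A : ℕ → Sequence → List ℕ} {L : Set ℕ} (hC : ConservativeOn A L)
include hC

/-- Closing imports only claims of extensions with content in `L`; conservativeness makes their
limit set `L` too, so induction on the stage applies. -/
theorem Claim.subset_of_limitSet_eq {s : ℕ} {σ : Sequence} {K : List ℕ} (hK : Claim A s σ K)
    (hσ : σ.content ⊆ L) (hL : limitSet A σ = L) : ∀ x ∈ K, x ∈ L := by
  induction s generalizing σ K with
  | zero =>
    rcases hK with hK | rfl
    · simp [history] at hK
    · exact fun x hx => hσ (mem_contentList.1 hx)
  | succ s ih =>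
    rcases claim_succ.1 hK with hK | ⟨-, -, rfl⟩
    · exact ih hK hσ hL
    · refine closeUnder_minimal (fun x hx => hL ▸ ⟨s, hx⟩) ?_
      rintro ⟨τ, K'⟩ hp hστ - hτ
      exact ih (Or.inl hp) hτ ((hC σ τ hστ hτ (hL ▸ hτ)).symm.trans hL)

variable (hA : ∀ {s t σ}, s ≤ t → A s σ ⊆ A t σ)
include hA

/-- All claims lie in `L` and so get verified. If `x` in `L` were never claimed, claims would stop
once `x` is enumerated; yet `σ` is selected again after all are verified, and must then claim `x`.
-/
theorem own_eq_of_unblocked {σ : Sequence} (hσ : σ.content ⊆ L) (hL : limitSet A σ = L)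
    (hfree : ∀ s ρ K, ρ <+: σ → ρ ≠ σ → Claim A s ρ K → ¬ contentList σ ⊆ K) :
    own A σ = L := by
  refine (hL ▸ own_subset_limitSet σ : own A σ ⊆ L).antisymm fun x hx => ?_
  by_contra hnot
  have hsat : ∀ l : List ℕ, (∀ y ∈ l, y ∈ L) → ∃ t, l ⊆ A t σ := fun l hl =>
    exists_stage_of_subset (fun h => hA h) l fun y hy => by
      have : y ∈ limitSet A σ := hL ▸ hl y hy
      exact this
  have hnoK : ∀ s K, Claim A s σ K → x ∉ K := by
    intro s K hK hxK
    obtain ⟨t, ht⟩ := hsat K (hK.subset_of_limitSet_eq hC hσ hL)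
    exact hnot ⟨max s t, mem_verified.2
      ⟨K, hK.mono (le_max_left _ _), List.Subset.trans ht (hA (le_max_right _ _)), hxK⟩⟩
  obtain ⟨s₀, hs₀⟩ : x ∈ limitSet A σ := hL ▸ hx
  have hstable : ∀ t ≥ s₀, ∀ K, Claim A t σ K → Claim A s₀ σ K := by
    intro t ht
    induction ht with
    | refl => exact fun K hK => hK
    | step ht ih =>
      intro K hK
      rcases claim_succ.1 hK with h | ⟨-, -, rfl⟩
      · exact ih K h
      · exact absurd (subset_closeUnder _ _ _ (hA ht hs₀)) (hnoK _ _ hK)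
  obtain ⟨t, ht⟩ : ∃ t, ∀ K, Claim A s₀ σ K → K ⊆ A t σ := by
    obtain ⟨t, ht⟩ := hsat
      (((history A s₀ ++ [(σ, contentList σ)]).filter fun p => p.1 = σ).flatMap Prod.snd) (by
        intro y hy
        obtain ⟨⟨τ, K⟩, hp, hyK⟩ := List.mem_flatMap.1 hy
        simp only [List.mem_filter, List.mem_append, List.mem_singleton, decide_eq_true_eq,
          Prod.mk.injEq] at hp
        obtain ⟨hp, rfl⟩ := hp
        exact Claim.subset_of_limitSet_eq hC (s := s₀) (hp.imp id And.right) hσ hL y hyK)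
    refine ⟨t, fun K hK y hy => ht (List.mem_flatMap.2 ⟨(σ, K), ?_, hy⟩)⟩
    simp only [List.mem_filter, List.mem_append, List.mem_singleton, Prod.mk.injEq, true_and,
      decide_true, and_true]
    exact hK
  -- The first component makes `selected s` equal to `σ`; the second makes the stage late enough.
  let s := Nat.pair (Encodable.encode σ) (max s₀ t)
  have hs : max s₀ t ≤ s := Nat.right_le_pair _ _
  have hsel : σ = selected s := by simp [s, selected]
  have hact : Acts A s σ := by
    refine ⟨fun K hK => ?_, fun ρ K h₁ h₂ h₃ => hfree s ρ K h₁ h₂ h₃⟩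
    exact List.Subset.trans (ht K (hstable s ((le_max_left _ _).trans hs) K hK))
      (hA ((le_max_right _ _).trans hs))
  exact hnoK (s + 1) _ (claim_succ.2 (Or.inr ⟨hsel, hact, rfl⟩))
    (subset_closeUnder _ _ _ (hA ((le_max_left _ _).trans hs) hs₀))

omit hC in
/-- If the limit set of `σ` misses part of the infinite content of a text, then eventually no claim
of `σ` covers the content of the initial segments of the text. -/
theorem exists_not_covered {T : Text} (hinf : T.content.Infinite) {σ : Sequence}
    (hσ : ¬ T.content ⊆ limitSet A σ) :
    ∃ N, ∀ n ≥ N, ∀ s K, Claim A s σ K → ¬ contentList (T.initial n) ⊆ K := by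
  obtain ⟨x, hx, hxσ⟩ := Set.not_subset.1 hσ
  obtain ⟨N, hN⟩ := exists_mem_content_initial hx
  -- A claim that is never verified is the largest one; being finite, it eventually misses an
  -- element of the text. All other claims lie in the limit set and miss `x`.
  by_cases h : ∃ s K, Claim A s σ K ∧ ∃ y ∈ K, y ∉ limitSet A σ
  · obtain ⟨s₀, K₀, hK₀, y, hy, hyσ⟩ := h
    obtain ⟨z, hz, hzK⟩ : ∃ z ∈ T.content, z ∉ K₀ := by
      by_contra hcon
      push Not at hcon
      exact hinf (K₀.finite_toSet.subset hcon)
    obtain ⟨M, hM⟩ := exists_mem_content_initial hz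
    refine ⟨max N M, fun n hn s K hK hsub => ?_⟩
    rcases (hK.mono (le_max_left s s₀)).nested @hA (hK₀.mono (le_max_right s s₀)) with
      rfl | ⟨-, h⟩ | ⟨-, h⟩
    · exact hzK (hsub (mem_contentList.2 (hM n ((le_max_right _ _).trans hn))))
    · exact hxσ ⟨_, h (hsub (mem_contentList.2 (hN n ((le_max_left _ _).trans hn))))⟩
    · exact hyσ ⟨_, h hy⟩
  · push Not at h
    exact ⟨N, fun n hn s K hK hsub => hxσ (h s K hK x (hsub (mem_contentList.2 (hN n hn))))⟩

/-- The new hypotheses converge behaviourally to the content of a text on which the old ones do. -/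
theorem eventually_output_eq {T : Text} (hT : T.content = L) {k : ℕ}
    (hk : ∀ n ≥ k, limitSet A (T.initial n) = L) :
    ∃ N, ∀ n ≥ N, output A (T.initial n) = L := by
  have hcont : ∀ n, (T.initial n).content ⊆ L := fun n => hT ▸ content_initial_subset T n
  -- Compare with the hypothesis at `max j k`, which is already correct.
  have hgood : ∀ j, L ⊆ limitSet A (T.initial j) → limitSet A (T.initial j) = L := fun j hj =>
    (hC _ _ (initial_prefix T (le_max_left j k)) (hcont _) ((hcont _).trans hj)).trans
      (hk _ (le_max_right j k))
  -- A never verified claim may cover all of a finite `L`, so that case relies on the trivial claim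
  -- of a segment exhausting `L`.
  rcases L.finite_or_infinite with hfin | hinf
  · have : ∃ N, ∀ n ≥ N, L ⊆ (T.initial n).content := by
      have hmem : ∀ x : ℕ, ∃ N, x ∈ L → ∀ n ≥ N, x ∈ (T.initial n).content := fun x => by
        by_cases hx : x ∈ L
        · obtain ⟨N, hN⟩ := exists_mem_content_initial (hT ▸ hx : x ∈ T.content)
          exact ⟨N, fun _ => hN⟩
        · exact ⟨0, fun h => absurd h hx⟩
      choose f hf using hmem
      refine ⟨hfin.toFinset.sup f, fun n hn x hx => hf x hx n (le_trans ?_ hn)⟩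
      exact Finset.le_sup (f := f) (hfin.mem_toFinset.2 hx)
    obtain ⟨N, hN⟩ := this
    refine ⟨max N k, fun n hn => ?_⟩
    have hLn : L ⊆ (T.initial n).content := hN n ((le_max_left _ _).trans hn)
    have hAn := hk n ((le_max_right _ _).trans hn)
    ext x
    rw [mem_output @hA]
    constructor
    · rintro ⟨ρ, hρ, h, hx⟩
      rcases h with rfl | h
      · exact hAn ▸ own_subset_limitSet _ hx
      · obtain ⟨j, -, rfl⟩ := eq_initial_of_prefix hρ
        rw [← hgood j ((hLn.trans h).trans (own_subset_limitSet _))]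
        exact own_subset_limitSet _ hx
    · intro hx
      refine ⟨_, List.prefix_refl _, Or.inl rfl, ?_⟩
      obtain ⟨s, hs⟩ := exists_stage_of_subset (B := fun s => A s (T.initial n)) (fun h => hA h)
        (contentList (T.initial n)) fun y hy => by
          have : y ∈ limitSet A (T.initial n) := hAn ▸ hcont n (mem_contentList.1 hy)
          exact this
      exact ⟨s, mem_verified.2 ⟨_, claim_trivial _ _, hs, mem_contentList.2 (hLn hx)⟩⟩
  · have hbad : ∀ j, ∃ N, ¬ L ⊆ limitSet A (T.initial j) → ∀ n ≥ N, ∀ s K,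
        Claim A s (T.initial j) K → ¬ contentList (T.initial n) ⊆ K := fun j => by
      by_cases hj : L ⊆ limitSet A (T.initial j)
      · exact ⟨0, fun h => absurd hj h⟩
      · obtain ⟨N, hN⟩ := exists_not_covered @hA (T := T) (hT ▸ hinf) (hT ▸ hj)
        exact ⟨N, fun _ => hN⟩
    choose f hf using hbad
    refine ⟨max ((Finset.range k).sup f) k, fun n hn => ?_⟩
    have hlim : ∀ j s K, Claim A s (T.initial j) K → contentList (T.initial n) ⊆ K →
        limitSet A (T.initial j) = L := by
      intro j s K hK hsub
      rcases le_or_gt k j with hj | hj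
      · exact hk j hj
      · refine hgood j (by_contra fun hcon => hf j hcon n ?_ s K hK hsub)
        exact (Finset.le_sup (f := f) (Finset.mem_range.2 hj)).trans ((le_max_left _ _).trans hn)
    have hAn := hk n ((le_max_right _ _).trans hn)
    have hex : ∃ j, j ≤ n ∧ ∃ s K, Claim A s (T.initial j) K ∧ contentList (T.initial n) ⊆ K :=
      ⟨n, le_rfl, 0, _, claim_trivial _ _, List.Subset.refl _⟩
    classical
    -- The least `j` with a claim covering the content seen is unblocked: a blocking claim of a
    -- proper prefix would contain `K` and contradict minimality.
    obtain ⟨hjn, s, K, hK, hsub⟩ := Nat.find_spec hex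
    have hmin := fun i => Nat.find_min' (m := i) hex
    generalize Nat.find hex = j at hjn hK hmin
    have hown : own A (T.initial j) = L := by
      refine own_eq_of_unblocked hC @hA (hcont j) (hlim j s K hK hsub) ?_
      intro t ρ K' hρ hne hK' hsub'
      obtain ⟨i, hij, rfl⟩ := eq_initial_of_prefix hρ
      have hKK' : K ⊆ K' := (hK'.mono (le_max_left t s)).subset_of_prefix
        (hK.mono (le_max_right t s)) hρ hne hsub'
      have hji := hmin i ⟨hij.trans hjn, t, K', hK', List.Subset.trans hsub hKK'⟩
      exact hne (by rw [le_antisymm hij hji])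
    ext x
    rw [mem_output @hA]
    constructor
    · rintro ⟨ρ, hρ, h, hx⟩
      rcases h with rfl | h
      · exact hAn ▸ own_subset_limitSet _ hx
      · obtain ⟨t, K', hK', -, hsub'⟩ := exists_claim_of_content_subset @hA hρ h
        obtain ⟨i, -, rfl⟩ := eq_initial_of_prefix hρ
        exact hlim i t K' hK' hsub' ▸ own_subset_limitSet _ hx
    · exact fun hx => ⟨_, initial_prefix T hjn, Or.inr (hown ▸ hcont n), hown ▸ hx⟩

end Convergence

/-! ### Primitive recursiveness of the construction -/

theorem primrecRel_prefix {α : Type*} [Primcodable α] :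
    PrimrecRel fun σ τ : List α => σ <+: τ :=
  (Primrec.eq.comp Primrec.fst
    (Primrec.list_take.comp (Primrec.list_length.comp Primrec.fst) Primrec.snd)).of_eq
    fun _ => List.prefix_iff_eq_take.symm

theorem primrecRel_mem {α : Type*} [Primcodable α] : PrimrecRel fun (a : α) (l : List α) => a ∈ l :=
  (PrimrecRel.exists_mem_list Primrec.eq).swap.of_eq fun a l => by simp

theorem primrecRel_subset {α : Type*} [Primcodable α] : PrimrecRel fun l l' : List α => l ⊆ l' :=
  PrimrecRel.forall_mem_list primrecRel_mem

theorem primrec_contentList : Primrec contentList :=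
  Primrec.listFilterMap Primrec.id Primrec.snd.to₂

theorem primrec_prefixes : Primrec prefixes :=
  Primrec.list_map (Primrec.list_range.comp (Primrec.succ.comp Primrec.list_length))
    (Primrec.list_take.comp Primrec.snd Primrec.fst).to₂

theorem primrecRel_forces : PrimrecRel Forces := by
  have h₁ : PrimrecPred fun q : (Sequence × List ℕ) × (Sequence × List ℕ) => q.2.1 <+: q.1.1 :=
    primrecRel_prefix.comp (Primrec.fst.comp Primrec.snd) (Primrec.fst.comp Primrec.fst)
  have h₂ : PrimrecPred fun q : (Sequence × List ℕ) × (Sequence × List ℕ) => q.2.1 = q.1.1 :=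
    Primrec.eq.comp (Primrec.fst.comp Primrec.snd) (Primrec.fst.comp Primrec.fst)
  have h₃ : PrimrecPred fun q : (Sequence × List ℕ) × (Sequence × List ℕ) =>
      contentList q.1.1 ⊆ q.2.2 :=
    primrecRel_subset.comp (primrec_contentList.comp (Primrec.fst.comp Primrec.fst))
      (Primrec.snd.comp Primrec.snd)
  exact (h₁.and h₂.not).and h₃

theorem primrecRel_permits : PrimrecRel Permits := by
  have h₁ : PrimrecPred fun q : (Sequence × List ℕ) × (Sequence × List ℕ) => q.1.1 = q.2.1 :=
    Primrec.eq.comp (Primrec.fst.comp Primrec.fst) (Primrec.fst.comp Primrec.snd)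
  have h₂ : PrimrecPred fun q : (Sequence × List ℕ) × (Sequence × List ℕ) => q.1.2 ⊆ q.2.2 :=
    primrecRel_subset.comp (Primrec.snd.comp Primrec.fst) (Primrec.snd.comp Primrec.snd)
  have h₃ : PrimrecPred fun q : (Sequence × List ℕ) × (Sequence × List ℕ) => q.1.1 <+: q.2.1 :=
    primrecRel_prefix.comp (Primrec.fst.comp Primrec.fst) (Primrec.fst.comp Primrec.snd)
  have h₄ : PrimrecPred fun q : (Sequence × List ℕ) × (Sequence × List ℕ) =>
      contentList q.2.1 ⊆ q.1.2 :=
    primrecRel_subset.comp (primrec_contentList.comp (Primrec.fst.comp Primrec.snd))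
      (Primrec.snd.comp Primrec.fst)
  refine ((h₁.not.or h₂).and ((h₃.and h₁.not).not.or h₄.not)).of_eq fun q => ?_
  unfold Permits
  tauto

theorem primrec_expand :
    Primrec fun q : (List (Sequence × List ℕ) × Sequence) × List ℕ => expand q.1.1 q.1.2 q.2 :=
  Primrec.list_append.comp Primrec.snd
    (Primrec.list_flatMap
      (primrecRel_forces.listFilter.comp (Primrec.fst.comp Primrec.fst)
        (Primrec.pair (Primrec.snd.comp Primrec.fst) Primrec.snd))
      (Primrec.snd.comp Primrec.snd).to₂)

theorem primrec_closeUnder :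
    Primrec fun q : (List (Sequence × List ℕ) × Sequence) × List ℕ =>
      closeUnder q.1.1 q.1.2 q.2 :=
  Primrec.nat_iterate (Primrec.list_length.comp (Primrec.fst.comp Primrec.fst)) Primrec.snd
    (primrec_expand.comp (Primrec.pair (Primrec.fst.comp Primrec.fst) Primrec.snd)).to₂

theorem primrec_withTrivial : Primrec₂ withTrivial :=
  Primrec.list_append.comp Primrec.fst
    (Primrec.list_map (primrec_prefixes.comp Primrec.snd)
      (Primrec.pair Primrec.snd (primrec_contentList.comp Primrec.snd)).to₂)

theorem primrec_selected : Primrec selected :=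
  (Primrec.ofNat Sequence).comp (Primrec.fst.comp Primrec.unpair)

section

variable {A : ℕ → Sequence → List ℕ} (hA : Primrec₂ A)
include hA

theorem primrec_history : Primrec (history A) := by
  have hσ : Primrec fun q : ℕ × List (Sequence × List ℕ) => selected q.1 :=
    primrec_selected.comp Primrec.fst
  have hAσ : Primrec fun q : ℕ × List (Sequence × List ℕ) => A q.1 (selected q.1) :=
    hA.comp Primrec.fst hσ
  have hcond : PrimrecPred fun q : ℕ × List (Sequence × List ℕ) =>
      ∀ p ∈ withTrivial q.2 (selected q.1), Permits p (selected q.1, A q.1 (selected q.1)) :=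
    primrecRel_permits.forall_mem_list.comp (primrec_withTrivial.comp Primrec.snd hσ)
      (Primrec.pair hσ hAσ)
  have hclose : Primrec fun q : ℕ × List (Sequence × List ℕ) =>
      closeUnder q.2 (selected q.1) (A q.1 (selected q.1)) :=
    primrec_closeUnder.comp (Primrec.pair (Primrec.pair Primrec.snd hσ) hAσ)
  have hstep := Primrec.ite hcond (Primrec.list_cons.comp (Primrec.pair hσ hclose) Primrec.snd)
    Primrec.snd
  refine (Primrec.nat_rec₁ [] hstep.to₂).of_eq fun s => ?_
  induction s with
  | zero => rfl
  | succ s ih => rw [history, ← ih]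

theorem primrec_verified : Primrec₂ (verified A) := by
  have hR : PrimrecRel fun (p : Sequence × List ℕ) (q : ℕ × Sequence) =>
      p.1 = q.2 ∧ p.2 ⊆ A q.1 q.2 :=
    (Primrec.eq.comp (Primrec.fst.comp Primrec.fst) (Primrec.snd.comp Primrec.snd)).and
      (primrecRel_subset.comp (Primrec.snd.comp Primrec.fst)
        (hA.comp (Primrec.fst.comp Primrec.snd) (Primrec.snd.comp Primrec.snd)))
  have htriv : Primrec fun q : ℕ × Sequence => [(q.2, contentList q.2)] :=
    Primrec.list_cons.comp (Primrec.pair Primrec.snd (primrec_contentList.comp Primrec.snd))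
      (Primrec.const [])
  exact Primrec.list_flatMap
    (hR.listFilter.comp
      (Primrec.list_append.comp ((primrec_history hA).comp Primrec.fst) htriv) Primrec.id)
    (Primrec.snd.comp Primrec.snd).to₂

theorem primrec_outputAt : Primrec₂ (outputAt A) := by
  have hR : PrimrecRel fun (ρ : Sequence) (q : ℕ × Sequence) =>
      ρ = q.2 ∨ contentList q.2 ⊆ verified A q.1 ρ :=
    (Primrec.eq.comp Primrec.fst (Primrec.snd.comp Primrec.snd)).or
      (primrecRel_subset.comp (primrec_contentList.comp (Primrec.snd.comp Primrec.snd))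
        ((primrec_verified hA).comp (Primrec.fst.comp Primrec.snd) Primrec.fst))
  exact Primrec.list_flatMap
    (hR.listFilter.comp (primrec_prefixes.comp Primrec.snd) Primrec.id)
    ((primrec_verified hA).comp (Primrec.fst.comp Primrec.fst) Primrec.snd).to₂

end

/-! ### Indices, approximations to the old learner, and the equality of classes -/

/-- Uniformly enumerated sets have computable indices. -/
theorem exists_computable_index {B : ℕ → Sequence → List ℕ} (hB : Primrec₂ B) :
    ∃ g : Sequence → ℕ, Computable g ∧ ∀ σ, W (g σ) = {x | ∃ s, x ∈ B s σ} := by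
  classical
  have hp : PrimrecPred fun q : ℕ × ℕ =>
      q.1.unpair.2 ∈ B q.2 (Denumerable.ofNat Sequence q.1.unpair.1) :=
    primrecRel_mem.comp (Primrec.snd.comp (Primrec.unpair.comp Primrec.fst))
      (hB.comp Primrec.snd
        ((Primrec.ofNat Sequence).comp (Primrec.fst.comp (Primrec.unpair.comp Primrec.fst))))
  -- On the pair of a code of `σ` and `x`, the search halts exactly when `x` is enumerated; currying
  -- in the code gives the index.
  have hf : Partrec fun n : ℕ => Nat.rfind fun s =>
      Part.some (decide (n.unpair.2 ∈ B s (Denumerable.ofNat Sequence n.unpair.1))) :=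
    Partrec.rfind (Computable.partrec hp.decide.to_comp).to₂
  obtain ⟨c, hc⟩ := Nat.Partrec.Code.exists_code.1 (Partrec.nat_iff.1 hf)
  refine ⟨fun σ => Encodable.encode (c.curry (Encodable.encode σ)), ?_, fun σ => ?_⟩
  · exact (Primrec.encode.comp
      (Nat.Partrec.Code.primrec₂_curry.comp (Primrec.const c) Primrec.encode)).to_comp
  · ext x
    simp only [W, phi, Denumerable.ofNat_encode, PFun.mem_dom]
    rw [← Part.dom_iff_mem, Nat.Partrec.Code.eval_curry, hc]
    refine Nat.rfind_dom.trans ?_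
    simp

/-- Stage `s` of the enumeration of the hypothesis that the program `c` outputs on `σ`. -/
def approx (c : Nat.Partrec.Code) (s : ℕ) (σ : Sequence) : List ℕ :=
  (List.range s).filterMap fun x =>
    ((c.evaln s (Encodable.encode σ)).bind fun e =>
      (Denumerable.ofNat Nat.Partrec.Code e).evaln s x).map fun _ => x

theorem primrec_approx (c : Nat.Partrec.Code) : Primrec₂ (approx c) := by
  have h₁ : Primrec fun q : (ℕ × Sequence) × ℕ => c.evaln q.1.1 (Encodable.encode q.1.2) :=
    Nat.Partrec.Code.primrec_evaln.comp (Primrec.pair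
      (Primrec.pair (Primrec.fst.comp Primrec.fst) (Primrec.const c))
      (Primrec.encode.comp (Primrec.snd.comp Primrec.fst)))
  have h₂ : Primrec₂ fun (q : (ℕ × Sequence) × ℕ) (e : ℕ) =>
      (Denumerable.ofNat Nat.Partrec.Code e).evaln q.1.1 q.2 :=
    Nat.Partrec.Code.primrec_evaln.comp (Primrec.pair
      (Primrec.pair (Primrec.fst.comp (Primrec.fst.comp Primrec.fst))
        ((Primrec.ofNat Nat.Partrec.Code).comp Primrec.snd))
      (Primrec.snd.comp Primrec.fst))
  exact Primrec.listFilterMap (Primrec.list_range.comp Primrec.fst)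
    (Primrec.option_map (Primrec.option_bind h₁ h₂) (Primrec.snd.comp Primrec.fst).to₂).to₂

theorem mem_approx {c : Nat.Partrec.Code} {s x : ℕ} {σ : Sequence} :
    x ∈ approx c s σ ↔ ∃ e ∈ c.evaln s (Encodable.encode σ),
      ∃ y, y ∈ (Denumerable.ofNat Nat.Partrec.Code e).evaln s x := by
  simp only [approx, List.mem_filterMap, List.mem_range, Option.map_eq_some_iff,
    Option.bind_eq_some_iff, Option.mem_def]
  constructor
  · rintro ⟨x, -, y, ⟨e, he, hy⟩, rfl⟩
    exact ⟨e, he, y, hy⟩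
  · rintro ⟨e, he, y, hy⟩
    -- The cut-off at `s` loses nothing, since `evaln s` only converges on inputs below `s`.
    exact ⟨x, Nat.Partrec.Code.evaln_bound hy, y, ⟨e, he, hy⟩, rfl⟩

theorem approx_mono (c : Nat.Partrec.Code) {s t : ℕ} {σ : Sequence} (h : s ≤ t) :
    approx c s σ ⊆ approx c t σ := by
  intro x hx
  obtain ⟨e, he, y, hy⟩ := mem_approx.1 hx
  exact mem_approx.2 ⟨e, Nat.Partrec.Code.evaln_mono h he, y, Nat.Partrec.Code.evaln_mono h hy⟩

theorem limitSet_approx {c : Nat.Partrec.Code} {σ : Sequence} {e : ℕ}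
    (he : e ∈ c.eval (Encodable.encode σ)) : limitSet (approx c) σ = W e := by
  ext x
  simp only [limitSet, Set.mem_ofPred_eq, mem_approx, W, phi, PFun.mem_dom]
  constructor
  · rintro ⟨s, e', he', y, hy⟩
    obtain rfl := Part.mem_unique he (Nat.Partrec.Code.evaln_sound he')
    exact ⟨y, Nat.Partrec.Code.evaln_sound hy⟩
  · rintro ⟨y, hy⟩
    obtain ⟨s, hs⟩ := Nat.Partrec.Code.evaln_complete.1 he
    obtain ⟨t, ht⟩ := Nat.Partrec.Code.evaln_complete.1 hy
    exact ⟨max s t, e, Nat.Partrec.Code.evaln_mono (le_max_left _ _) hs, y,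
      Nat.Partrec.Code.evaln_mono (le_max_right _ _) ht⟩

theorem exists_code_of_partrec {h : Sequence →. ℕ} (hh : Partrec h) :
    ∃ c : Nat.Partrec.Code, ∀ σ, c.eval (Encodable.encode σ) = h σ := by
  obtain ⟨c, hc⟩ := Nat.Partrec.Code.exists_code.1 hh
  exact ⟨c, fun σ => by simp [hc, Part.map_id']⟩

/-- Every sequence over `L` starts a text of `L`. -/
theorem exists_text_extending {L : Set ℕ} {σ : Sequence} (hσ : σ.content ⊆ L) :
    ∃ T : Text, T.IsTextOf L ∧ T.initial σ.length = σ := by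
  classical
  refine ⟨fun n => if h : n < σ.length then σ[n] else
    if n - σ.length ∈ L then some (n - σ.length) else none, ?_, ?_⟩
  · ext x
    constructor
    · rintro ⟨n, hn⟩
      dsimp only at hn
      split_ifs at hn with h₁ h₂
      · exact hσ (show some x ∈ σ from hn ▸ List.getElem_mem h₁)
      · cases hn
        exact h₂
    · exact fun hx => ⟨σ.length + x, by simp [hx]⟩
  · refine List.ext_getElem (initial_length _ _) fun n h₁ h₂ => ?_
    simp [Text.initial, h₂]

theorem mem_of_gold_eq {h : Sequence →. ℕ} {T : Text} {q : ℕ → ℕ} (hq : gold h T = (q : ℕ →. ℕ))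
    (n : ℕ) : q n ∈ h (T.initial n) := by
  have : gold h T n = Part.some (q n) := congrFun hq n
  rw [gold] at this
  exact this ▸ Part.mem_some _

/-- The old learner is constrained only on texts of `L`, but every sequence over `L` begins such a
text. -/
theorem conservativeOn_approx {h : Sequence →. ℕ} {c : Nat.Partrec.Code}
    (hc : ∀ σ, c.eval (Encodable.encode σ) = h σ) {L : Set ℕ}
    (hL : ∀ T : Text, T.IsTextOf L → ∃ q : ℕ → ℕ, gold h T = (q : ℕ →. ℕ) ∧ SemConv q T) :
    ConservativeOn (approx c) L := by
  intro σ τ hστ hτ hsub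
  obtain ⟨T, hT, hinit⟩ := exists_text_extending hτ
  obtain ⟨q, hq, hconv⟩ := hL T hT
  have hlim : ∀ n, limitSet (approx c) (T.initial n) = W (q n) := fun n =>
    limitSet_approx (hc (T.initial n) ▸ mem_of_gold_eq hq n)
  rw [← hinit] at hστ hsub ⊢
  obtain ⟨m, hm, rfl⟩ := eq_initial_of_prefix hστ
  rcases hm.lt_or_eq with hm | rfl
  · rw [hlim] at hsub
    rw [hlim, hlim]
    exact hconv _ _ hm hsub
  · rfl

end LimitLearning

theorem mainTheorem5 :
    Learnable (Restriction.ofTotal SemConv) gold (Restriction.ofTotal Bc) =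
      Learnable Restriction.none gold
        (Restriction.ofTotal fun p T => SemConv p T ∧ Bc p T) := by
  ext 𝓛
  constructor
  · rintro ⟨h, hh, hlearn⟩
    -- The same learner works; the total sequences witnessing the two restrictions coincide.
    refine ⟨h, hh, fun L hL => ⟨fun _ => trivial, fun T hT => ?_⟩⟩
    obtain ⟨q, hq, hconv⟩ := (hlearn L hL).1 T
    obtain ⟨q', hq', hbc⟩ := (hlearn L hL).2 T hT
    have : q = q' := PFun.lift_injective (hq.symm.trans hq')
    exact ⟨q, hq, hconv, this ▸ hbc⟩
  · rintro ⟨h, hh, hlearn⟩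
    obtain ⟨c, hc⟩ := exists_code_of_partrec hh
    obtain ⟨g, hg, hW⟩ := exists_computable_index (primrec_outputAt (primrec_approx c))
    have hW' : ∀ σ, W (g σ) = output (approx c) σ := hW
    refine ⟨(g : Sequence →. ℕ), hg.partrec, fun L hL => ⟨fun T => ?_, fun T hT => ?_⟩⟩
    · refine ⟨fun n => g (T.initial n), rfl, fun n m hnm hsub => ?_⟩
      change W (g (T.initial n)) = W (g (T.initial m))
      change Sequence.content (T.initial m) ⊆ W (g (T.initial n)) at hsub
      rw [hW'] at hsub
      rw [hW', hW']
      exact output_eq_of_content_subset (A := approx c) (σ := T.initial n) (τ := T.initial m)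
        (approx_mono c) (initial_prefix T hnm.le) hsub
    · refine ⟨fun n => g (T.initial n), rfl, ?_⟩
      have hcons : ConservativeOn (approx c) L := conservativeOn_approx hc fun T' hT' => by
        obtain ⟨q, hq, hconv, -⟩ := (hlearn L hL).2 T' hT'
        exact ⟨q, hq, hconv⟩
      obtain ⟨q, hq, -, k, hk⟩ := (hlearn L hL).2 T hT
      have hlim : ∀ n ≥ k, limitSet (approx c) (T.initial n) = L := fun n hn => by
        rw [limitSet_approx (hc (T.initial n) ▸ mem_of_gold_eq hq n), hk n hn, hT]
      obtain ⟨N, hN⟩ := eventually_output_eq hcons (approx_mono c) hT hlim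
      exact ⟨N, fun n hn => by rw [hW', hN n hn, hT]⟩
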